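/- **Setting.** Fix two agents $1,2$ and a finite set $\mathit{AP}$ of atomic propositions. A concurrent game structure (CGS) $\mathcal G=(S,s_0,A,\kappa,L)$ consists of a finite set $S$ of states, an initial state $s_0\in S$, a non-empty finite set $A$ of actions, a transition function $\kappa:S\times(\{1,2\}\to A)\to S$ and a labelling $L:S\to 2^{\mathit{AP}}$. A strategy is a function $f:S^+\to A$. For $s\in S$, the play of a pair $(f_1,f_2)$ of strategies (agent $i$ uses $f_i$) from $s$ is the path $p\in S^\omega$ with $p(0)=s$ and $p(j+1)=\kappa\big(p(j),(f_1(p[0,j]),f_2(p[0,j]))\big)$, where $p[0,j]=p(0)\cdots p(j)$. Let $\psi$ be an LTL formula over the indexed propositions $a_{\pi_1},a_{\pi_2}$ ($a\in\mathit{AP}$), built with $\neg$, $\wedge$, next and until. It is evaluated synchronously on pairs of paths: $a_{\pi_i}$ holds if $a$ labels the current state of the $i$-th path. In Hyper Strategy Logic (HyperSL), $$\mathcal G\models\exists x.\,\exists y.\,\forall z.\,\forall w.\ \psi\big[\pi_1:(x,z),\ \pi_2:(y,w)\big]$$ means: there are strategies $x,y$ in $\mathcal G$ such that for all strategies $z,w$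 in $\mathcal G$, the pair consisting of the play of $(x,z)$ from $s_0$ (as $\pi_1$) and the play of $(y,w)$ from $s_0$ (as $\pi_2$) satisfies $\psi$. **Lemma.** Model checking HyperSL formulas of the form $\exists x.\exists y.\forall z.\forall w.\,\psi[\pi_1:(x,z),\pi_2:(y,w)]$ is undecidable in general. That is, there is a finite set $\mathit{AP}$ for which no algorithm decides, given a CGS $\mathcal G$ (as an explicit finite table) and an LTL formula $\psi$ over the propositions $a_{\pi_1},a_{\pi_2}$, whether $$\mathcal G\models\exists x.\,\exists y.\,\forall z.\,\forall w.\ \psi\big[\pi_1:(x,z),\ \pi_2:(y,w)\big].$$ -/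

import Mathlib

/-- A concurrent game structure with agents `Agt`, atomic propositions `AP`, states `S` and
actions `A`.  In the decision problem below, all four types are finite. -/
structure CGS (Agt AP S A : Type) where
  init : S
  trans : S → (Agt → A) → S
  label : S → Set AP

/-- A strategy `S⁺ → A`, where `S⁺` is the union of all `S^(j+1)`: `f j h` is the action chosen
after the finite play `h 0, …, h j`. -/
abbrev Strategy (S A : Type) : Type := (j : ℕ) → (Fin (j + 1) → S) → A

/-- The path `p` with `p 0 = s` and `p (j+1) = κ (p j, ∏ i, f i (p[0,j]))`. -/
def CGS.play {Agt AP S A : Type} (G : CGS Agt AP S A) (s : S) (f : Agt → Strategy S A) : ℕ → S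
  | 0 => s
  | j + 1 => G.trans (CGS.play G s f j) fun i => f i j fun t : Fin (j + 1) => CGS.play G s f t.1
  termination_by j => j
  decreasing_by
    · exact Nat.lt_succ_self _
    · exact t.2

mutual

/-- Path formulas of HyperSL, with strategy variables `X` and path variables `V`. -/
inductive PathFormula (Agt AP X V : Type) : Type
  | atom (a : AP) (p : V)
  | state (φ : StateFormula Agt AP X V) (p : V)
  | and (ψ₁ ψ₂ : PathFormula Agt AP X V)
  | not (ψ : PathFormula Agt AP X V)
  | next (ψ : PathFormula Agt AP X V)
  | untl (ψ₁ ψ₂ : PathFormula Agt AP X V)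

/-- State formulas of HyperSL; `bind ψ [(π₁, x₁), …, (πₘ, xₘ)]` is `ψ[π₁ : x₁, …, πₘ : xₘ]`. -/
inductive StateFormula (Agt AP X V : Type) : Type
  | all (x : X) (φ : StateFormula Agt AP X V)
  | ex (x : X) (φ : StateFormula Agt AP X V)
  | bind (ψ : PathFormula Agt AP X V) (b : List (V × (Agt → X)))

end

/-- The path assignment that maps the `k`-th path variable to the play from `s` in which agent `i`
uses the strategy assigned to the strategy variable `xₖ i`.  It is undefined on the other path
variables, and where a required strategy variable is unassigned. -/
noncomputable def CGS.bindPaths {Agt AP S A X V : Type} [DecidableEq V]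
    (G : CGS Agt AP S A) (s : S) (Δ : X → Option (Strategy S A)) (b : List (V × (Agt → X))) :
    V → Option (ℕ → S) :=
  open Classical in
  fun p => (b.lookup p).bind fun x =>
    if h : ∀ i, (Δ (x i)).isSome then some (G.play s fun i => (Δ (x i)).get (h i)) else none

/-- The shifted path assignment `Π[j, ∞]`. -/
def shiftPaths {S V : Type} (P : V → Option (ℕ → S)) (j : ℕ) : V → Option (ℕ → S) :=
  fun p => (P p).map fun u n => u (j + n)

mutual

/-- `Π ⊨ ψ`, for a partial path assignment `Π`. -/
def PathFormula.Sat {Agt AP S A X V : Type} [DecidableEq X] [DecidableEq V]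
    (G : CGS Agt AP S A) : PathFormula Agt AP X V → (V → Option (ℕ → S)) → Prop
  | .atom a p, P => ∃ u, P p = some u ∧ a ∈ G.label (u 0)
  | .state φ p, P => ∃ u, P p = some u ∧ StateFormula.Sat G φ (u 0) (fun _ => none)
  | .and ψ₁ ψ₂, P => PathFormula.Sat G ψ₁ P ∧ PathFormula.Sat G ψ₂ P
  | .not ψ, P => ¬ PathFormula.Sat G ψ P
  | .next ψ, P => PathFormula.Sat G ψ (shiftPaths P 1)
  | .untl ψ₁ ψ₂, P => ∃ j, PathFormula.Sat G ψ₂ (shiftPaths P j) ∧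
      ∀ k < j, PathFormula.Sat G ψ₁ (shiftPaths P k)

/-- `s, Δ ⊨ φ`, for a partial strategy assignment `Δ`. -/
def StateFormula.Sat {Agt AP S A X V : Type} [DecidableEq X] [DecidableEq V]
    (G : CGS Agt AP S A) : StateFormula Agt AP X V → S → (X → Option (Strategy S A)) → Prop
  | .all x φ, s, Δ => ∀ f : Strategy S A, StateFormula.Sat G φ s (Function.update Δ x (some f))
  | .ex x φ, s, Δ => ∃ f : Strategy S A, StateFormula.Sat G φ s (Function.update Δ x (some f))
  | .bind ψ b, s, Δ => PathFormula.Sat G ψ (G.bindPaths s Δ b)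

end

/-- `𝒢 ⊨ φ`: the initial state satisfies `φ` under the empty strategy assignment. -/
def CGS.Models {Agt AP S A X V : Type} [DecidableEq X] [DecidableEq V]
    (G : CGS Agt AP S A) (φ : StateFormula Agt AP X V) : Prop :=
  φ.Sat G G.init fun _ => none

/-- LTL formulas over atomic propositions `AP` indexed by path variables `V`. -/
inductive LTL (AP V : Type) : Type
  | atom (a : AP) (p : V)
  | not (ψ : LTL AP V)
  | next (ψ : LTL AP V)
  | and (ψ₁ ψ₂ : LTL AP V)
  | untl (ψ₁ ψ₂ : LTL AP V)

/-- LTL formulas are the HyperSL path formulas without nested state formulas. -/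
def LTL.toPath {Agt AP X V : Type} : LTL AP V → PathFormula Agt AP X V
  | .atom a p => .atom a p
  | .not ψ => .not ψ.toPath
  | .next ψ => .next ψ.toPath
  | .and ψ₁ ψ₂ => .and ψ₁.toPath ψ₂.toPath
  | .untl ψ₁ ψ₂ => .untl ψ₁.toPath ψ₂.toPath

/-! ### Inputs of the decision problem: encoding of LTL formulas (Polish notation) -/

namespace LTL

/-- Symbols of Polish notation: an indexed proposition, or one of `0 = ¬`, `1 = next`, `2 = ∧`,
`3 = until`. -/
abbrev Tok (AP V : Type) : Type := (AP × V) ⊕ Fin 4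

/-- The Polish notation of a formula. -/
def tokens {AP V : Type} : LTL AP V → List (Tok AP V)
  | .atom a p => [Sum.inl (a, p)]
  | .not ψ => Sum.inr 0 :: ψ.tokens
  | .next ψ => Sum.inr 1 :: ψ.tokens
  | .and ψ₁ ψ₂ => Sum.inr 2 :: (ψ₁.tokens ++ ψ₂.tokens)
  | .untl ψ₁ ψ₂ => Sum.inr 3 :: (ψ₁.tokens ++ ψ₂.tokens)

def arity {AP V : Type} (t : Tok AP V) : ℕ :=
  Sum.elim (fun _ => 0) (fun c : Fin 4 => if c.val < 2 then 1 else 2) t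

/-- The number of formulas of which a word is the concatenation (`none` if there is none). -/
def count {AP V : Type} (w : List (Tok AP V)) : Option ℕ :=
  w.foldr (fun t o => o.bind fun n => if arity t ≤ n then some (n - arity t + 1) else none) (some 0)

def WF {AP V : Type} (w : List (Tok AP V)) : Prop := count w = some 1

instance instDecidableWF {AP V : Type} : DecidablePred (WF : List (Tok AP V) → Prop) :=
  fun w => inferInstanceAs (Decidable (count w = some 1))

theorem count_cons {AP V : Type} (t : Tok AP V) (w : List (Tok AP V)) :
    count (t :: w) =
      (count w).bind fun n => if arity t ≤ n then some (n - arity t + 1) else none := rfl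

theorem count_tokens_append {AP V : Type} (ψ : LTL AP V) :
    ∀ w : List (Tok AP V), count (ψ.tokens ++ w) = (count w).map (· + 1) := by
  induction ψ with
  | atom a p => intro w; cases h : count w <;> simp [tokens, count_cons, arity, h]
  | not ψ ih => intro w; cases h : count w <;> simp [tokens, count_cons, arity, ih, h]
  | next ψ ih => intro w; cases h : count w <;> simp [tokens, count_cons, arity, ih, h]
  | and ψ χ ih₁ ih₂ =>
    intro w; cases h : count w <;> simp [tokens, count_cons, arity, ih₁, ih₂, h]
  | untl ψ χ ih₁ ih₂ =>
    intro w; cases h : count w <;> simp [tokens, count_cons, arity, ih₁, ih₂, h]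

theorem wf_tokens {AP V : Type} (ψ : LTL AP V) : WF ψ.tokens := by
  have h := count_tokens_append ψ []
  rw [List.append_nil] at h
  exact h

theorem tokens_append_inj {AP V : Type} (ψ : LTL AP V) :
    ∀ (χ : LTL AP V) (u v : List (Tok AP V)),
      ψ.tokens ++ u = χ.tokens ++ v → ψ = χ ∧ u = v := by
  induction ψ with
  | atom a p =>
    intro χ u v h
    cases χ <;> simp_all [tokens]
  | not ψ ih =>
    intro χ u v h
    cases χ <;> simp [tokens] at h
    simpa using ih _ _ _ h
  | next ψ ih =>
    intro χ u v h
    cases χ <;> simp [tokens] at h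
    simpa using ih _ _ _ h
  | and ψ₁ ψ₂ ih₁ ih₂ =>
    intro χ u v h
    cases χ <;> simp [tokens] at h
    obtain ⟨h₁, h⟩ := ih₁ _ _ _ h
    obtain ⟨h₂, h⟩ := ih₂ _ _ _ h
    exact ⟨by rw [h₁, h₂], h⟩
  | untl ψ₁ ψ₂ ih₁ ih₂ =>
    intro χ u v h
    cases χ <;> simp [tokens] at h
    obtain ⟨h₁, h⟩ := ih₁ _ _ _ h
    obtain ⟨h₂, h⟩ := ih₂ _ _ _ h
    exact ⟨by rw [h₁, h₂], h⟩

theorem exists_of_count {AP V : Type} (w : List (Tok AP V)) :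
    ∀ n, count w = some n → ∃ l : List (LTL AP V), l.length = n ∧ l.flatMap tokens = w := by
  induction w with
  | nil =>
    intro n h
    simp only [count, List.foldr_nil, Option.some.injEq] at h
    exact ⟨[], by simpa using h, rfl⟩
  | cons t w ih =>
    intro n h
    rw [count_cons] at h
    obtain ⟨m, hm, h⟩ := Option.bind_eq_some_iff.1 h
    obtain ⟨l, hl, hw⟩ := ih m hm
    split_ifs at h with har
    rw [Option.some.injEq] at h
    rcases t with ⟨a, p⟩ | c
    · refine ⟨.atom a p :: l, ?_, ?_⟩
      · simp only [arity, Sum.elim_inl] at h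
        simp only [List.length_cons]; omega
      · simp [tokens, hw]
    · fin_cases c
      · rcases l with _ | ⟨ψ, l⟩
        · simp [arity] at har; simp at hl; omega
        · refine ⟨.not ψ :: l, ?_, by rw [← hw]; simp [tokens]⟩
          simp [arity] at h hl ⊢; omega
      · rcases l with _ | ⟨ψ, l⟩
        · simp [arity] at har; simp at hl; omega
        · refine ⟨.next ψ :: l, ?_, by rw [← hw]; simp [tokens]⟩
          simp [arity] at h hl ⊢; omega
      · rcases l with _ | ⟨ψ, _ | ⟨χ, l⟩⟩
        · simp [arity] at har; simp at hl; omega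
        · simp [arity] at har; simp at hl; omega
        · refine ⟨.and ψ χ :: l, ?_, by rw [← hw]; simp [tokens]⟩
          simp [arity] at h hl ⊢; omega
      · rcases l with _ | ⟨ψ, _ | ⟨χ, l⟩⟩
        · simp [arity] at har; simp at hl; omega
        · simp [arity] at har; simp at hl; omega
        · refine ⟨.untl ψ χ :: l, ?_, by rw [← hw]; simp [tokens]⟩
          simp [arity] at h hl ⊢; omega

/-- Formulas correspond to well-formed words through Polish notation. -/
noncomputable def equivWords (AP V : Type) : LTL AP V ≃ {w : List (Tok AP V) // WF w} :=
  Equiv.ofBijective (fun ψ => ⟨ψ.tokens, wf_tokens ψ⟩) <| by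
    constructor
    · intro ψ χ h
      have h' : ψ.tokens = χ.tokens := congrArg Subtype.val h
      exact (tokens_append_inj ψ χ [] [] (by rw [h'])).1
    · rintro ⟨w, hw⟩
      obtain ⟨l, hl, rfl⟩ := exists_of_count w 1 hw
      obtain ⟨ψ, rfl⟩ := List.length_eq_one_iff.1 hl
      exact ⟨ψ, Subtype.ext (by simp)⟩

theorem primrec_count {AP V : Type} [Primcodable AP] [Primcodable V] :
    Primrec (count : List (Tok AP V) → Option ℕ) := by
  have har : Primrec (arity : Tok AP V → ℕ) :=
    (Primrec.sumCasesOn (f := fun t : Tok AP V => t) (g := fun _ _ => 0)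
      (h := fun _ c => if c.val < 2 then 1 else 2) Primrec.id (Primrec.const 0).to₂
      ((Primrec.dom_finite (fun c : Fin 4 => if c.val < 2 then 1 else 2)).comp
        Primrec.snd).to₂).of_eq (fun t => by cases t <;> rfl)
  have hstep : Primrec₂ (fun (_ : List (Tok AP V)) (q : Tok AP V × Option ℕ) =>
      q.2.bind fun n => if arity q.1 ≤ n then some (n - arity q.1 + 1) else none) := by
    refine Primrec.option_bind (Primrec.snd.comp Primrec.snd) ?_
    have h1 : Primrec (fun p : (List (Tok AP V) × (Tok AP V × Option ℕ)) × ℕ => arity p.1.2.1) :=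
      har.comp (Primrec.fst.comp (Primrec.snd.comp Primrec.fst))
    exact Primrec.ite (Primrec.nat_le.comp h1 Primrec.snd)
      (Primrec.option_some.comp (Primrec.succ.comp (Primrec.nat_sub.comp Primrec.snd h1)))
      (Primrec.const none)
  exact Primrec.list_foldr Primrec.id (Primrec.const (some 0)) hstep

theorem primrecPred_wf {AP V : Type} [Primcodable AP] [Primcodable V] :
    PrimrecPred (WF : List (Tok AP V) → Prop) :=
  Primrec.eq.comp primrec_count (Primrec.const (some 1))

/-- A formula is input to an algorithm as its Polish notation. -/
noncomputable instance instPrimcodable {AP V : Type} [Primcodable AP] [Primcodable V] :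
    Primcodable (LTL AP V) :=
  letI := Primcodable.subtype (primrecPred_wf (AP := AP) (V := V))
  Primcodable.ofEquiv _ (equivWords AP V)

end LTL

/-! ### Inputs of the decision problem: encoding of finite two-agent game structures -/

/-- An explicit finite table for a game structure with two agents (`0` and `1`), atomic
propositions `Fin k`, states `0, …, n` and actions `0, …, m`: the initial state, the successor
`table[s][a₀][a₁]`, and the list `labels[s]` of the propositions that hold in `s`. -/
structure CGSCode (k : ℕ) where
  n : ℕ
  m : ℕ
  start : ℕ
  table : List (List (List ℕ))
  labels : List (List (Fin k))

def CGSCode.equivProd (k : ℕ) :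
    CGSCode k ≃ ℕ × ℕ × ℕ × List (List (List ℕ)) × List (List (Fin k)) where
  toFun c := (c.n, c.m, c.start, c.table, c.labels)
  invFun d := ⟨d.1, d.2.1, d.2.2.1, d.2.2.2.1, d.2.2.2.2⟩
  left_inv _ := rfl
  right_inv _ := rfl

instance CGSCode.instPrimcodable (k : ℕ) : Primcodable (CGSCode k) :=
  Primcodable.ofEquiv _ (CGSCode.equivProd k)

/-- The game structure given by a table (missing entries are read as `0` or as the empty list,
states out of range modulo `n + 1`). -/
def CGSCode.toCGS {k : ℕ} (c : CGSCode k) :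
    CGS (Fin 2) (Fin k) (Fin (c.n + 1)) (Fin (c.m + 1)) where
  init := Fin.ofNat (c.n + 1) c.start
  trans s a := Fin.ofNat (c.n + 1) (((c.table.getD s []).getD (a 0) []).getD (a 1) 0)
  label s := {p | p ∈ c.labels.getD s []}

/-- Every game structure with states `0, …, n` and actions `0, …, m` is given by a table. -/
theorem CGSCode.exists_code {k n m : ℕ} (G : CGS (Fin 2) (Fin k) (Fin (n + 1)) (Fin (m + 1))) :
    ∃ (t : List (List (List ℕ))) (l : List (List (Fin k))),
      (CGSCode.mk n m G.init t l).toCGS = G := by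
  classical
  refine ⟨List.ofFn fun s => List.ofFn fun a => List.ofFn fun b => (G.trans s ![a, b]).val,
    List.ofFn fun s => (Finset.univ.filter (· ∈ G.label s)).toList, ?_⟩
  rcases G with ⟨i, κ, L⟩
  simp only [CGSCode.toCGS, CGS.mk.injEq]
  refine ⟨by simp, ?_, ?_⟩
  · funext s a
    have ha : ![a 0, a 1] = a := by ext j; fin_cases j <;> rfl
    simp [List.getD_eq_getElem?_getD, ha, -List.ofFn_succ, Fin.is_le]
  · funext s
    ext p
    simp [List.getD_eq_getElem?_getD, -List.ofFn_succ, Fin.is_le]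

/-! ### The formulas `∃x ∃y ∀z ∀w. ψ[π₁ : (x, z), π₂ : (y, w)]` -/

/-- The strategy variables of the formula. -/
inductive SVar : Type
  | x | y | z | w
  deriving DecidableEq

/-- `∃x ∃y ∀z ∀w. ψ[π₁ : (x, z), π₂ : (y, w)]`; the path variables `π₁`, `π₂` are `0`, `1`, and
`![x, z]` assigns `x` to the first agent and `z` to the second. -/
def crossedFormula {AP : Type} (ψ : LTL AP (Fin 2)) : StateFormula (Fin 2) AP SVar (Fin 2) :=
  .ex .x <| .ex .y <| .all .z <| .all .w <|
    .bind ψ.toPath [(0, ![SVar.x, SVar.z]), (1, ![SVar.y, SVar.w])]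

-- The halting problem of one fixed Turing machine is reduced to the complement of the model
-- checking problem. The game is fixed: in each step the first agent chooses a bit and the second a
-- tape cell, and the state records both. The bit in state `j + 1` is chosen when exactly the `j`
-- letters in states `1, …, j` are visible. Since earlier bits are determined by earlier letters, a
-- strategy of the first agent amounts to a set of accepted finite words, and the second agent can
-- spell any infinite word. Thus `x` and `y` are two languages, and `∀z ∀w` ranges over pairs of
-- words read in lockstep.
--
-- The LTL formula says that the language is an inductive invariant of the machine: `x` accepts the
-- input padded with blanks; if `x` accepts a word, then `y` accepts every word obtained by one
-- local rewriting; whatever `y` accepts, `x` accepts; `x` accepts no word with a halting cell.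
-- Consecutive configurations are compared on parallel paths, so only two adjacent positions are
-- inspected at a time. Two languages are needed because each path is tied to its own strategy; the
-- agreement condition closes the loop.
--
-- If the machine does not halt, the words that show a segment of a reachable configuration form
-- such an invariant (`holdsAt_invariantFormula_of_not_halts`). Conversely, an invariant contains
-- all sufficiently wide segments of every reachable configuration, so none is halted
-- (`not_halts_of_holdsAt_invariantFormula`). As the propositions are the game states, the machine
-- must not depend on the instance; its input enters through the formula only.

/-! ### A fixed finite Turing machine with an undecidable halting problem -/

/-- Binary successor, least significant digit first. -/
def binSucc : List Bool → List Bool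
  | [] => [true]
  | false :: l => true :: l
  | true :: l => false :: binSucc l

/-- Binary digits, least significant digit first. -/
def binDigits (n : ℕ) : List Bool := binSucc^[n] []

theorem primrec_binSucc : Primrec binSucc := by
  have h : Primrec₂ fun (_ : List Bool) (q : Bool × List Bool × List Bool) =>
      bif q.1 then false :: q.2.2 else true :: q.2.1 :=
    Primrec.cond (Primrec.fst.comp Primrec.snd)
      (Primrec.list_cons.comp (Primrec.const false)
        (Primrec.snd.comp (Primrec.snd.comp Primrec.snd)))
      (Primrec.list_cons.comp (Primrec.const true)
        (Primrec.fst.comp (Primrec.snd.comp Primrec.snd)))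
  refine (Primrec.list_rec Primrec.id (Primrec.const [true]) h).of_eq fun l => ?_
  induction l with
  | nil => rfl
  | cons b l ih => cases b <;> simp_all [binSucc]

theorem primrec_binDigits : Primrec binDigits :=
  (Primrec.nat_iterate Primrec.id (Primrec.const []) (primrec_binSucc.comp Primrec.snd).to₂).of_eq
    fun _ => rfl

section
open Turing PartrecToTM2

theorem trPosNum_succ (p : PosNum) : ∀ l : List Bool,
    trPosNum p = l.map (fun b => bif b then Γ'.bit1 else Γ'.bit0) →
      trPosNum p.succ = (binSucc l).map fun b => bif b then Γ'.bit1 else Γ'.bit0 := by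
  induction p with
  | one =>
    rintro (_ | ⟨_ | _, _ | ⟨b, l⟩⟩) h <;> simp_all [trPosNum, binSucc, PosNum.succ]
  | bit1 p ih =>
    rintro (_ | ⟨_ | _, l⟩) h
    · simp [trPosNum] at h
    · simp [trPosNum] at h
    · have := ih l (by simpa [trPosNum] using h)
      simpa [trPosNum, binSucc, PosNum.succ] using this
  | bit0 p _ =>
    rintro (_ | ⟨_ | _, l⟩) h <;> simp_all [trPosNum, binSucc, PosNum.succ]

/-- Rewrites the machine's encoding of numbers as an iterate of `binSucc`, a form in which it is
primitive recursive. -/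
theorem trNat_eq_binDigits (n : ℕ) :
    trNat n = (binDigits n).map fun b => bif b then Γ'.bit1 else Γ'.bit0 := by
  induction n with
  | zero => simp [trNat_zero, binDigits]
  | succ n ih =>
    rw [binDigits, Function.iterate_succ_apply', ← binDigits]
    simp only [trNat, Nat.cast_succ, Num.add_one] at ih ⊢
    cases h : (n : Num) with
    | zero =>
      rw [h] at ih
      have hn : binDigits n = [] := by simpa [trNum] using ih.symm
      simp [hn, binSucc, Num.succ, Num.succ', trNum, trPosNum]
    | pos p =>
      rw [h] at ih
      simpa [Num.succ, Num.succ', trNum] using trPosNum_succ p _ ih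

instance : Finite K' :=
  Finite.of_injective (β := Fin 4)
    (fun k => match k with | .main => 0 | .rev => 1 | .aux => 2 | .stack => 3)
    (by rintro ⟨⟩ ⟨⟩ h <;> simp_all)

/-- Every finite type has a `Primcodable` structure. -/
theorem exists_primcodable (α : Type) [Finite α] : Nonempty (Primcodable α) := by
  obtain ⟨n, ⟨e⟩⟩ := Finite.exists_equiv_fin α
  exact ⟨Primcodable.ofEquiv _ e⟩

/-- The function is universal: it runs the code with number `n` on input `0`, so its domain encodes
the halting problem. -/
theorem exists_partrec_halting_undecidable :
    ∃ f : ℕ →. ℕ, Partrec f ∧ ¬ ComputablePred fun n => (f n).Dom := by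
  refine ⟨fun n => (Denumerable.ofNat Nat.Partrec.Code n).eval 0,
    Nat.Partrec.Code.eval_part.comp (Computable.ofNat _) (Computable.const 0), fun h => ?_⟩
  refine ComputablePred.halting_problem 0 (ComputablePred.computable_of_manyOneReducible
    ⟨fun c => Encodable.encode c, Computable.encode, fun c => ?_⟩ h)
  simp

/-- The halting problem of a Turing machine of finite support is that of a finite machine. -/
theorem exists_finite_machine {Γ Λ : Type} [Inhabited Γ] [Inhabited Λ] (M : TM0.Machine Γ Λ)
    (S : Finset Λ) (ss : TM0.Supports M (S : Set Λ)) :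
    ∃ (_ : Inhabited S) (M' : TM0.Machine Γ S), ∀ l,
      (StateTransition.eval (TM0.step M') (TM0.init l)).Dom ↔
        (StateTransition.eval (TM0.step M) (TM0.init l)).Dom := by
  classical
  let d : S := ⟨default, ss.1⟩
  refine ⟨⟨d⟩, ?_⟩
  let : Inhabited S := ⟨d⟩
  -- States outside `S` collapse to the default one; this is harmless, as by `ss` a run never leaves
  -- `S`.
  let g₁ : PointedMap Λ S := ⟨fun q => if h : q ∈ S then ⟨q, h⟩ else d, by
    have : (default : Λ) ∈ S := ss.1
    simp only [this, dite_true]; rfl⟩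
  let g₂ : S → Λ := Subtype.val
  let i : PointedMap Γ Γ := ⟨id, rfl⟩
  have hi : ∀ T : Tape Γ, T.map i = T := by
    rintro ⟨a, L, R⟩
    simp only [Tape.map, Tape.mk.injEq]
    exact ⟨rfl, ListBlank.ext fun n => by rw [ListBlank.nth_map]; rfl,
      ListBlank.ext fun n => by rw [ListBlank.nth_map]; rfl⟩
  refine ⟨M.map i i g₁ g₂, fun l => ?_⟩
  refine StateTransition.tr_eval_dom
    (TM0.Machine.map_respects M i i g₁ g₂ ss (fun _ => rfl) ?_) ⟨ss.1, ?_⟩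
  · intro q hq
    have hq' : q ∈ S := hq
    change ((if h : q ∈ S then (⟨q, h⟩ : S) else d) : S).1 = q
    rw [dif_pos hq']
  · rw [TM0.map_init i g₁]
    congr 1
    exact List.map_id _

/-- There is a finite Turing machine whose halting problem is undecidable, for inputs that start
with a fixed symbol. -/
theorem exists_machine_halting_undecidable :
    ∃ (Γ Λ : Type) (_ : Inhabited Γ) (_ : Inhabited Λ) (_ : Finite Γ) (_ : Finite Λ)
      (_ : Primcodable Γ) (M : TM0.Machine Γ Λ) (a : Γ) (r : ℕ → List Γ), Computable r ∧
      ¬ ComputablePred fun n => (StateTransition.eval (TM0.step M) (TM0.init (a :: r n))).Dom := by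
  obtain ⟨f, hf, hund⟩ := exists_partrec_halting_undecidable
  obtain ⟨c, hc⟩ := ToPartrec.Code.exists_code (Nat.Partrec'.part_iff₁.2 hf)
  let : Inhabited Λ' := ⟨trNormal c Cont'.halt⟩
  let : Fintype K' := Fintype.ofFinite _
  -- A finite support survives the translations from stack machine to `TM1` to `TM0`, so finitely
  -- many states suffice.
  have ss := TM1to0.tr_supports _ (TM2to1.tr_supports _ (tr_supports c Cont'.halt))
  obtain ⟨_, M', hM'⟩ := exists_finite_machine _ _ ss
  obtain ⟨_⟩ := exists_primcodable (TM2to1.Γ' K' fun _ => PartrecToTM2.Γ')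
  let g : PartrecToTM2.Γ' → TM2to1.Γ' K' fun _ => PartrecToTM2.Γ' :=
    fun a => (false, Function.update (fun _ => none) K'.main (some a))
  let g' : Bool → TM2to1.Γ' K' fun _ => PartrecToTM2.Γ' :=
    fun b => g (bif b then Γ'.bit1 else Γ'.bit0)
  -- The stack is written bottom first, so the tape starts with the separator `cons`, marked `true`
  -- as the stack bottom, for every `n`.
  refine ⟨_, _, inferInstance, inferInstance, inferInstance, inferInstance, inferInstance, M',
    (true, (g Γ'.cons).2), fun n => (binDigits n).reverse.map g', ?_, ?_⟩
  · exact (Primrec.list_map (Primrec.list_reverse.comp primrec_binDigits)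
      ((Primrec.dom_finite g').comp Primrec.snd).to₂).to_comp
  · convert hund using 3 with n
    rw [hM']
    have hl : (true, (g Γ'.cons).2) :: (binDigits n).reverse.map g' =
        TM2to1.trInit K'.main (trList [n]) := by
      have hrev : (trList [n]).reverse =
          Γ'.cons :: (binDigits n).reverse.map fun b => bif b then Γ'.bit1 else Γ'.bit0 := by
        simp [trList, trNat_eq_binDigits]
      rw [TM2to1.trInit, hrev]
      change _ = (true, (g Γ'.cons).2) :: ((binDigits n).reverse.map _).map g
      rw [List.map_map]
      rfl
    change (StateTransition.eval _
      (TM0.init ((true, (g Γ'.cons).2) :: (binDigits n).reverse.map g'))).Dom ↔ _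
    rw [hl]
    have h1 := TM1to0.tr_eval (TM2to1.tr tr) (TM2to1.trInit K'.main (trList [n]))
    have h2 := TM2to1.tr_eval_dom (σ := Option Γ') tr K'.main (trList [n])
    rw [← h1] at h2
    refine Iff.trans ?_ (h2.trans ?_)
    · rfl
    · have h3 : TM2.init K'.main (trList [n]) = init c [n] := by
        rw [TM2.init, init]
        congr 1
        funext k
        cases k <;> rfl
      have h4 := hc ⟨[n], rfl⟩
      have h5 := tr_eval c [n]
      rw [show c.eval [n] = _ from h4] at h5
      change (StateTransition.eval (TM2.step tr) (TM2.init K'.main (trList [n]))).Dom ↔ _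
      rw [h3, h5]
      rfl

end

/-! ### Semantics of LTL on families of paths -/

/-- `ρ ⊨ ψ` at position `j`. -/
def LTL.HoldsAt {AP V S : Type} (lab : S → Set AP) : LTL AP V → (V → ℕ → S) → ℕ → Prop
  | .atom a p, ρ, j => a ∈ lab (ρ p j)
  | .not ψ, ρ, j => ¬ ψ.HoldsAt lab ρ j
  | .next ψ, ρ, j => ψ.HoldsAt lab ρ (j + 1)
  | .and ψ₁ ψ₂, ρ, j => ψ₁.HoldsAt lab ρ j ∧ ψ₂.HoldsAt lab ρ j
  | .untl ψ₁ ψ₂, ρ, j => ∃ d, ψ₂.HoldsAt lab ρ (j + d) ∧ ∀ i < d, ψ₁.HoldsAt lab ρ (j + i)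

theorem LTL.sat_toPath {Agt AP S A X V : Type} [DecidableEq X] [DecidableEq V]
    (G : CGS Agt AP S A) (ψ : LTL AP V) (ρ : V → ℕ → S) (j : ℕ) :
    PathFormula.Sat G (ψ.toPath (X := X)) (fun p => some fun n => ρ p (j + n)) ↔
      ψ.HoldsAt G.label ρ j := by
  have hs : ∀ j d, shiftPaths (fun p => some fun n => ρ p (j + n)) d =
      fun p => some fun n => ρ p (j + d + n) := fun j d => by
    funext p; simp [shiftPaths, Nat.add_assoc]
  induction ψ generalizing j with
  | atom a p => simp [toPath, PathFormula.Sat, HoldsAt]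
  | not ψ ih => simp [toPath, PathFormula.Sat, HoldsAt, ih]
  | next ψ ih => simp only [toPath, PathFormula.Sat, HoldsAt, hs, ih]
  | and ψ₁ ψ₂ ih₁ ih₂ => simp [toPath, PathFormula.Sat, HoldsAt, ih₁, ih₂]
  | untl ψ₁ ψ₂ ih₁ ih₂ => simp only [toPath, PathFormula.Sat, HoldsAt, hs, ih₁, ih₂]

theorem LTL.holdsAt_succ {AP V S : Type} (lab : S → Set AP) (ψ : LTL AP V) (ρ : V → ℕ → S)
    (j : ℕ) : ψ.HoldsAt lab ρ (j + 1) ↔ ψ.HoldsAt lab (fun p n => ρ p (n + 1)) j := by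
  induction ψ generalizing j with
  | atom a p => rfl
  | not ψ ih => simp only [HoldsAt, ih]
  | next ψ ih => simp only [HoldsAt, ih]
  | and ψ₁ ψ₂ ih₁ ih₂ => simp only [HoldsAt, ih₁, ih₂]
  | untl ψ₁ ψ₂ ih₁ ih₂ => simp only [HoldsAt, Nat.add_right_comm j 1, ih₁, ih₂]

theorem models_crossedFormula_iff {AP S A : Type} (G : CGS (Fin 2) AP S A) (ψ : LTL AP (Fin 2)) :
    G.Models (crossedFormula ψ) ↔ ∃ x y : Strategy S A, ∀ z w : Strategy S A,
      ψ.HoldsAt G.label ![G.play G.init ![x, z], G.play G.init ![y, w]] 0 := by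
  simp only [CGS.Models, crossedFormula, StateFormula.Sat]
  refine exists_congr fun x => exists_congr fun y => forall_congr' fun z => forall_congr' fun w => ?_
  rw [← LTL.sat_toPath (X := SVar) G]
  apply iff_of_eq
  congr 1
  have two : ∀ (Δ : SVar → Option (Strategy S A)) (l : List (Fin 2 × (Fin 2 → SVar))) (p : Fin 2)
      (f : Fin 2 → SVar) (a b : Strategy S A), l.lookup p = some f →
      Δ (f 0) = some a → Δ (f 1) = some b →
      G.bindPaths G.init Δ l p = some (G.play G.init ![a, b]) := by
    intro Δ l p f a b hl ha hb
    rw [CGS.bindPaths, hl, Option.bind_some]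
    have h : ∀ i, (Δ (f i)).isSome := by
      intro i; fin_cases i <;> simp [ha, hb]
    rw [dif_pos h]
    congr 2
    funext i
    fin_cases i <;> simp [ha, hb]
  obtain ⟨Δ, hΔ⟩ : ∃ Δ : SVar → Option (Strategy S A), Δ = Function.update (Function.update
    (Function.update (Function.update (fun _ => none) .x (some x)) .y (some y)) .z (some z))
    .w (some w) := ⟨_, rfl⟩
  rw [← hΔ]
  simp only [Nat.zero_add]
  funext p
  fin_cases p
  · exact two Δ _ 0 ![SVar.x, SVar.z] x z rfl (by simp [hΔ]) (by simp [hΔ])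
  · exact two Δ _ 1 ![SVar.y, SVar.w] y w rfl (by simp [hΔ]) (by simp [hΔ])

/-! ### LTL formulas for predicates on pairs of states -/

namespace LTL

variable {S : Type} [Inhabited S]

/-- The disjunction of a list of formulas. -/
def disj (l : List (LTL S (Fin 2))) : LTL S (Fin 2) :=
  l.foldr (fun φ ψ => .not (.and (.not φ) (.not ψ)))
    (.and (.atom default 0) (.not (.atom default 0)))

theorem holdsAt_disj (l : List (LTL S (Fin 2))) (ρ : Fin 2 → ℕ → S) (j : ℕ) :
    (disj l).HoldsAt (fun s => {s}) ρ j ↔ ∃ φ ∈ l, φ.HoldsAt (fun s => {s}) ρ j := by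
  induction l with
  | nil => simp [disj, HoldsAt]
  | cons φ l ih =>
    simp only [disj] at ih
    simp only [disj, List.foldr_cons, HoldsAt, ih, List.mem_cons, exists_eq_or_imp]
    rw [← or_iff_not_and_not]

variable [Fintype S]

open Classical in
/-- The two current states are related by `R`. -/
noncomputable def pairPred (R : S → S → Prop) : LTL S (Fin 2) :=
  disj ((Finset.univ.filter fun t : S × S => R t.1 t.2).toList.map fun t =>
    .and (.atom t.1 0) (.atom t.2 1))

@[simp]
theorem holdsAt_pairPred (R : S → S → Prop) (ρ : Fin 2 → ℕ → S) (j : ℕ) :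
    (pairPred R).HoldsAt (fun s => {s}) ρ j ↔ R (ρ 0 j) (ρ 1 j) := by
  rw [pairPred, holdsAt_disj]
  simp only [List.mem_map, Finset.mem_toList, Finset.mem_filter, Finset.mem_univ, true_and,
    Prod.exists]
  constructor
  · rintro ⟨_, ⟨s, t, h, rfl⟩, h₁, h₂⟩
    simp only [HoldsAt, Set.mem_singleton_iff] at h₁ h₂
    rwa [← h₁, ← h₂]
  · exact fun h => ⟨_, ⟨_, _, h, rfl⟩, rfl, rfl⟩

/-- The two current states and the two next states are related by `W`. -/
noncomputable def window (W : S → S → S → S → Prop) : LTL S (Fin 2) :=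
  disj ((Finset.univ : Finset (S × S)).toList.map fun t =>
    .and (pairPred fun s s' => s = t.1 ∧ s' = t.2) (.next (pairPred (W t.1 t.2))))

@[simp]
theorem holdsAt_window (W : S → S → S → S → Prop) (ρ : Fin 2 → ℕ → S) (j : ℕ) :
    (window W).HoldsAt (fun s => {s}) ρ j ↔
      W (ρ 0 j) (ρ 1 j) (ρ 0 (j + 1)) (ρ 1 (j + 1)) := by
  rw [window, holdsAt_disj]
  simp only [List.mem_map, Finset.mem_toList, Finset.mem_univ, true_and, Prod.exists]
  constructor
  · rintro ⟨_, ⟨s, t, rfl⟩, h₁, h₂⟩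
    simp only [HoldsAt, holdsAt_pairPred] at h₁ h₂
    rwa [h₁.1, h₁.2]
  · exact fun h => ⟨_, ⟨ρ 0 j, ρ 1 j, rfl⟩, by simpa [HoldsAt] using h⟩

end LTL

/-! ### The game in which the first agent answers words with bits -/

section Game

variable {S L : Type} (e : S ≃ Bool × L)

/-- In every step, the first agent chooses a bit and the second agent a letter. -/
def bitGame (s₀ : S) : CGS (Fin 2) S S S where
  init := s₀
  trans _ a := e.symm ((e (a 0)).1, (e (a 1)).2)
  label s := {s}

variable (s₀ : S)

/-- The strategy of the second agent that plays the letters `u`. -/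
def letterStrategy (u : ℕ → L) : Strategy S S := fun j _ => e.symm (default, u j)

open Classical in
/-- The strategy of the first agent that answers a word according to whether it satisfies `P`. -/
noncomputable def bitStrategy [Inhabited L] (P : (j : ℕ) → (Fin j → L) → Prop) : Strategy S S :=
  fun j h => e.symm (decide (P j fun t => (e (h t.succ)).2), default)

theorem play_bitGame_succ (x z : Strategy S S) (j : ℕ) :
    (bitGame e s₀).play s₀ ![x, z] (j + 1) =
      e.symm ((e (x j fun t => (bitGame e s₀).play s₀ ![x, z] t)).1,
        (e (z j fun t => (bitGame e s₀).play s₀ ![x, z] t)).2) := by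
  rw [CGS.play]; rfl

theorem play_letterStrategy (x : Strategy S S) (u : ℕ → L) (j : ℕ) :
    (e ((bitGame e s₀).play s₀ ![x, letterStrategy e u] (j + 1))).2 = u j := by
  simp [play_bitGame_succ, letterStrategy]

/-- The index shift is essential: the bit in state `j + 1` answers the `j` letters before it, not
the letter it shares its state with. The initial state carries no letter. -/
theorem play_bitStrategy [Inhabited L] (P : (j : ℕ) → (Fin j → L) → Prop) (z : Strategy S S) (j : ℕ) :
    (e ((bitGame e s₀).play s₀ ![bitStrategy e P, z] (j + 1))).1 = true ↔
      P j fun t => (e ((bitGame e s₀).play s₀ ![bitStrategy e P, z] (t + 1))).2 := by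
  rw [play_bitGame_succ]
  simp only [Equiv.apply_symm_apply, bitStrategy, decide_eq_true_iff]
  rfl

end Game

/-! ### Words of tape cells -/

section Cells

open Turing

variable {Γ Λ : Type} [Inhabited Γ]

/-- A tape cell: its symbol, and the machine state if the head is there. -/
abbrev TapeCell (Γ Λ : Type) : Type := Γ × Option Λ

open Classical in
/-- The cell at position `i`, when the head is at position `h`. -/
noncomputable def tapeCell (c : TM0.Cfg Γ Λ) (h i : ℤ) : TapeCell Γ Λ :=
  (c.Tape.nth (i - h), if i = h then some c.q else none)

/-- A state is written only in the head cell, so seeing one locates the head. -/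
theorem tapeCell_snd_eq_some {c : TM0.Cfg Γ Λ} {h i : ℤ} {γ : Γ} {q : Λ}
    (hc : tapeCell c h i = (γ, some q)) : i = h ∧ q = c.q ∧ γ = c.Tape.head := by
  simp only [tapeCell, Prod.mk.injEq] at hc
  obtain ⟨h₁, h₂⟩ := hc
  split_ifs at h₂ with hi
  subst hi
  rw [sub_self, Tape.nth_zero] at h₁
  exact ⟨rfl, (Option.some.inj h₂).symm, h₁.symm⟩

variable [Inhabited Λ]

/-- The pairs `a, b` of adjacent cells can become `a', b'` in one step of the machine. -/
def CellStep (M : TM0.Machine Γ Λ) (a a' b b' : TapeCell Γ Λ) : Prop :=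
  ∃ q q' γ β,
    (∃ d, M q γ = some (q', .write d) ∧ a = (γ, some q) ∧ a' = (d, some q') ∧
      b = (β, none) ∧ b' = (β, none)) ∨
    (M q γ = some (q', .move .right) ∧ a = (γ, some q) ∧ a' = (γ, none) ∧
      b = (β, none) ∧ b' = (β, some q')) ∨
    (M q γ = some (q', .move .left) ∧ a = (β, none) ∧ a' = (β, some q') ∧
      b = (γ, some q) ∧ b' = (γ, none))

/-- The machine halts at this cell. -/
def CellHalt (M : TM0.Machine Γ Λ) (a : TapeCell Γ Λ) : Prop :=
  ∃ q, a.2 = some q ∧ M q a.1 = none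

/-- A rewriting of the cells of a configuration produces the cells of the next configuration. -/
theorem exists_step_of_cellStep (M : TM0.Machine Γ Λ) (c : TM0.Cfg Γ Λ) (h i : ℤ)
    {a' b' : TapeCell Γ Λ} (hs : CellStep M (tapeCell c h i) a' (tapeCell c h (i + 1)) b') :
    ∃ c' h', c' ∈ TM0.step M c ∧ a' = tapeCell c' h' i ∧ b' = tapeCell c' h' (i + 1) ∧
      ∀ t, t ≠ i → t ≠ i + 1 → tapeCell c' h' t = tapeCell c h t := by
  obtain ⟨q₀, T⟩ := c
  obtain ⟨q, q', γ, β, ⟨d, hM, ha, rfl, hb, rfl⟩ | ⟨hM, ha, rfl, hb, rfl⟩ |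
    ⟨hM, ha, rfl, hb, rfl⟩⟩ := hs
  · obtain ⟨rfl, rfl, rfl⟩ := tapeCell_snd_eq_some ha
    refine ⟨⟨q', T.write d⟩, i, by simp_all [TM0.step], by simp [tapeCell, -Tape.nth_zero], ?_, ?_⟩
    · rw [← hb]; simp [tapeCell]
    · intro t h₁ h₂
      have : t - i ≠ 0 := by omega
      simp [tapeCell, h₁, this]
  · obtain ⟨rfl, rfl, rfl⟩ := tapeCell_snd_eq_some ha
    refine ⟨⟨q', T.move .right⟩, i + 1, by simp_all [TM0.step], by simp [tapeCell], ?_, ?_⟩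
    · simp [tapeCell, -Tape.nth_zero] at hb ⊢
      exact hb.symm
    · intro t h₁ h₂
      have : t - (i + 1) + 1 = t - i := by omega
      simp [tapeCell, h₁, h₂, this]
  · obtain ⟨rfl, rfl, rfl⟩ := tapeCell_snd_eq_some hb
    refine ⟨⟨q', T.move .left⟩, i, by simp_all [TM0.step], ?_, by simp [tapeCell], ?_⟩
    · simp [tapeCell, -Tape.nth_zero] at ha ⊢
      exact ha.symm
    · intro t h₁ h₂
      have : t - i - 1 = t - (i + 1) := by omega
      simp [tapeCell, h₁, h₂, this]

/-- A step of the machine rewrites two adjacent cells. -/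
theorem exists_cellStep_of_step (M : TM0.Machine Γ Λ) {c c' : TM0.Cfg Γ Λ}
    (hs : c' ∈ TM0.step M c) :
    ∃ x y : ℤ, -1 ≤ x ∧ x ≤ 0 ∧ -1 ≤ y ∧ y ≤ 1 ∧ ∀ h i h', i = h + x → h' = h + y →
      CellStep M (tapeCell c h i) (tapeCell c' h' i) (tapeCell c h (i + 1))
        (tapeCell c' h' (i + 1)) ∧
      ∀ t, t ≠ i → t ≠ i + 1 → tapeCell c h t = tapeCell c' h' t := by
  obtain ⟨q, T⟩ := c
  obtain ⟨⟨q', s⟩, hM, rfl⟩ := Option.map_eq_some_iff.1 hs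
  rcases s with (_ | _) | d
  -- `x` is the offset of the left rewritten cell from the head, and `y` the displacement of the
  -- head.
  · refine ⟨-1, -1, by omega, by omega, by omega, by omega, fun h i h' hi hh => ?_⟩
    obtain rfl : i = h - 1 := by omega
    obtain rfl : h' = h - 1 := by omega
    refine ⟨⟨q, q', T.head, T.nth (-1), .inr (.inr ⟨hM, ?_, ?_, ?_, ?_⟩)⟩, fun t h₁ h₂ => ?_⟩
    · simp [tapeCell, -Tape.nth_zero]
    · simp [tapeCell, -Tape.nth_zero]
    · simp [tapeCell]
    · have : h ≠ h - 1 := by omega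
      simp [tapeCell, this]
    · have : t - (h - 1) - 1 = t - h := by omega
      have h₃ : t ≠ h := by omega
      simp [tapeCell, h₁, h₃, this]
  · refine ⟨0, 1, by omega, by omega, by omega, by omega, fun h i h' hi hh => ?_⟩
    obtain rfl : h = i := by omega
    obtain rfl : h' = h + 1 := by omega
    refine ⟨⟨q, q', T.head, T.nth 1, .inr (.inl ⟨hM, ?_, ?_, ?_, ?_⟩)⟩, fun t h₁ h₂ => ?_⟩
    · simp [tapeCell]
    · simp [tapeCell]
    · simp [tapeCell, -Tape.nth_zero]
    · simp [tapeCell, -Tape.nth_zero]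
    · have : t - (h + 1) + 1 = t - h := by omega
      simp [tapeCell, h₁, h₂, this]
  · refine ⟨0, 0, by omega, by omega, by omega, by omega, fun h i h' hi hh => ?_⟩
    obtain rfl : h = i := by omega
    obtain rfl : h' = h := by omega
    refine ⟨⟨q, q', T.head, T.nth 1, .inl ⟨d, hM, ?_, ?_, ?_, ?_⟩⟩, fun t h₁ h₂ => ?_⟩
    · simp [tapeCell]
    · simp [tapeCell, -Tape.nth_zero]
    · simp [tapeCell, -Tape.nth_zero]
    · simp [tapeCell, -Tape.nth_zero]
    · have : t - h' ≠ 0 := by omega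
      simp [tapeCell, h₁, this]

/-- The cells of an initial tape, without the blanks around them. -/
def inputCells (a : Γ) (l : List Γ) : List (TapeCell Γ Λ) :=
  (a, some default) :: l.map fun b => (b, none)

theorem tape_nth_mk₁_nat (l : List Γ) (n : ℕ) :
    (Turing.Tape.mk₁ l).nth n = l.getI n := by
  rw [Tape.mk₁, Tape.mk₂, Tape.mk'_nth_nat, ListBlank.nth_mk]

theorem tape_nth_mk₁_neg (l : List Γ) {z : ℤ} (hz : z < 0) :
    (Tape.mk₁ l).nth z = default := by
  obtain ⟨n, rfl⟩ : ∃ n : ℕ, z = -(n + 1 : ℕ) := ⟨(-z - 1).toNat, by omega⟩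
  change (Tape.mk₁ l).left.nth n = default
  simp [Tape.mk₁, Tape.mk₂, Tape.mk', ListBlank.nth_mk]

theorem tapeCell_init (a : Γ) (l : List Γ) (h t : ℤ) :
    (∀ i : ℕ, ∀ hi : i < (inputCells (Λ := Λ) a l).length, t = h + i →
      tapeCell (TM0.init (a :: l) : TM0.Cfg Γ Λ) h t = (inputCells a l)[i]) ∧
    (t < h ∨ h + (inputCells (Λ := Λ) a l).length ≤ t →
      tapeCell (TM0.init (a :: l) : TM0.Cfg Γ Λ) h t = (default, none)) := by
  refine ⟨?_, ?_⟩
  · rintro i hi rfl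
    have h1 : h + (i : ℤ) - h = i := by omega
    simp only [tapeCell, TM0.init, h1, tape_nth_mk₁_nat]
    rcases i with _ | i
    · simp [inputCells]
    · simp only [inputCells, List.length_cons, List.length_map, Nat.add_lt_add_iff_right] at hi
      have h2 : ¬ (i : ℤ) + 1 = 0 := by omega
      simp [inputCells, h2, List.getI_eq_getElem _ hi, List.getI_cons_succ]
  · rintro (ht | ht)
    · have h2 : t ≠ h := by omega
      simp [tapeCell, TM0.init, tape_nth_mk₁_neg _ (show t - h < 0 by omega), h2]
    · simp only [inputCells, List.length_cons, List.length_map] at ht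
      obtain ⟨n, rfl⟩ : ∃ n : ℕ, t = h + n := ⟨(t - h).toNat, by omega⟩
      have h1 : h + (n : ℤ) - h = n := by omega
      have h2 : h + (n : ℤ) ≠ h := by omega
      simp only [tapeCell, TM0.init, h1, tape_nth_mk₁_nat, h2, if_false]
      rw [List.getI_eq_default]
      simp; omega

end Cells

/-! ### The formula that asks for an inductive invariant -/

section Invariant

open Turing LTL

variable {S Γ Λ : Type} [Inhabited S] [Fintype S] [Inhabited Γ]
  (e : S ≃ Bool × TapeCell Γ Λ)

/-- The letters of the two current states agree. -/
noncomputable def sameLetter : LTL S (Fin 2) := pairPred fun s t => (e s).2 = (e t).2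

/-- The letter of the current state of the first path is `a`. -/
noncomputable def letterIs (a : TapeCell Γ Λ) : LTL S (Fin 2) := pairPred fun s _ => (e s).2 = a

/-- The first path continues with `l` and then blanks, and does not accept this word. -/
noncomputable def inputTail (l : List (TapeCell Γ Λ)) : LTL S (Fin 2) :=
  l.foldr (fun a φ => .and (letterIs e a) (.next φ))
    (.untl (letterIs e (default, none)) (pairPred fun s _ => (e s).1 = false))

/-- The first path does not accept the word `l`, surrounded by blanks. -/
noncomputable def inputViolation (l : List (TapeCell Γ Λ)) : LTL S (Fin 2) :=
  .untl (letterIs e (default, none)) (inputTail e l)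

theorem holdsAt_inputTail (l : List (TapeCell Γ Λ)) (ρ : Fin 2 → ℕ → S) (j : ℕ) :
    (inputTail e l).HoldsAt (fun s => {s}) ρ j ↔
      (∀ i, ∀ hi : i < l.length, (e (ρ 0 (j + i))).2 = l[i]) ∧
      ∃ d, (e (ρ 0 (j + l.length + d))).1 = false ∧
        ∀ t < d, (e (ρ 0 (j + l.length + t))).2 = (default, none) := by
  induction l generalizing j with
  | nil => simp [inputTail, HoldsAt, letterIs]
  | cons a l ih =>
    have : (inputTail e (a :: l)).HoldsAt (fun s => {s}) ρ j ↔
        (e (ρ 0 j)).2 = a ∧ (inputTail e l).HoldsAt (fun s => {s}) ρ (j + 1) := by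
      simp [inputTail, HoldsAt, letterIs]
    rw [this, ih, ← and_assoc]
    have e1 : ∀ d, j + 1 + l.length + d = j + (a :: l).length + d := fun d => by
      simp only [List.length_cons]; omega
    simp only [e1]
    refine and_congr_left fun _ => ⟨fun h i hi => ?_, fun h => ⟨h 0 (by simp), fun i hi => ?_⟩⟩
    · rcases i with _ | i
      · exact h.1
      · have := h.2 i (by simpa using hi)
        rwa [show j + 1 + i = j + (i + 1) by omega] at this
    · have := h (i + 1) (by simpa using hi)
      rwa [show j + (i + 1) = j + 1 + i by omega] at this

variable [Inhabited Λ] (M : TM0.Machine Γ Λ)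

/-- The first path accepts a word, and the second path does not accept a word to which it can be
rewritten in one step. -/
noncomputable def stepViolation : LTL S (Fin 2) :=
  .untl (sameLetter e) <|
    .and (window fun s s' t t' => CellStep M (e s).2 (e s').2 (e t).2 (e t').2) <|
      .next <| .next <| .untl (sameLetter e) <| pairPred fun s t => (e s).1 = true ∧ (e t).1 = false

/-- The second path accepts a word that the first path does not accept. -/
noncomputable def agreementViolation : LTL S (Fin 2) :=
  .untl (sameLetter e) <| pairPred fun s t => (e s).1 = false ∧ (e t).1 = true

/-- The first path accepts a word that represents a halted configuration. -/
noncomputable def haltViolation : LTL S (Fin 2) :=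
  .untl (pairPred fun _ _ => True) <|
    .and (pairPred fun s _ => CellHalt M (e s).2) <|
      .next <| .untl (pairPred fun _ _ => True) <| pairPred fun s _ => (e s).1 = true

/-- The accepted words are an inductive invariant that excludes the halted configurations. -/
noncomputable def invariantFormula (l : List (TapeCell Γ Λ)) : LTL S (Fin 2) :=
  .next <| .and
    (.and (.not (stepViolation e M)) (.and (.not (agreementViolation e)) (.not (haltViolation e M))))
    (.not (inputViolation e l))

/-- The word `w` shows a part of the tape of a configuration that is reachable from `c₀`. -/
def ShowsReachable (c₀ : TM0.Cfg Γ Λ) (j : ℕ) (w : Fin j → TapeCell Γ Λ) : Prop :=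
  ∃ c h, TM0.Reaches M c₀ c ∧ ∀ i : Fin j, w i = tapeCell c h (i : ℕ)

/-- Each violation is refuted on segments. A rewritten pair contains the head, so the rewriting is a
genuine machine step; a halting cell would exhibit a reachable halted configuration; the padded
input shows the initial one. -/
theorem holdsAt_invariantFormula_of_not_halts (a : Γ) (l : List Γ)
    (hh : ¬ (StateTransition.eval (TM0.step M) (TM0.init (a :: l))).Dom)
    (p q : ℕ → S)
    (hp : ∀ j, (e (p (j + 1))).1 = true ↔
      ShowsReachable M (TM0.init (a :: l)) j fun t => (e (p (t + 1))).2)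
    (hq : ∀ j, (e (q (j + 1))).1 = true ↔
      ShowsReachable M (TM0.init (a :: l)) j fun t => (e (q (t + 1))).2) :
    (invariantFormula e M (inputCells a l)).HoldsAt (fun s => {s}) ![p, q] 0 := by
  have hq' : ∀ j, (e (q (j + 1))).1 = false ↔
      ¬ ShowsReachable M (TM0.init (a :: l)) j fun t => (e (q (t + 1))).2 := fun j => by
    rw [← hq, Bool.not_eq_true]
  have hp' : ∀ j, (e (p (j + 1))).1 = false ↔
      ¬ ShowsReachable M (TM0.init (a :: l)) j fun t => (e (p (t + 1))).2 := fun j => by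
    rw [← hp, Bool.not_eq_true]
  -- The outer `next` drops the initial state: position `j` now holds letter `j` and the bit for the
  -- letters before it.
  rw [invariantFormula, HoldsAt, holdsAt_succ]
  refine ⟨⟨?_, ?_, ?_⟩, ?_⟩
  · rintro ⟨i, ⟨hw, d, hb, h₂⟩, h₁⟩
    simp only [holdsAt_window, holdsAt_pairPred, sameLetter, Matrix.cons_val_zero,
      Matrix.cons_val_one, Nat.zero_add, hp, hq'] at hw hb h₁ h₂
    obtain ⟨⟨c, h, hr, hc⟩, hn⟩ := hb
    have hi : (e (p (i + 1))).2 = tapeCell c h i := hc ⟨i, by omega⟩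
    have hi' : (e (p (i + 1 + 1))).2 = tapeCell c h (i + 1 : ℤ) := hc ⟨i + 1, by omega⟩
    rw [hi, hi'] at hw
    obtain ⟨c', h', hs, ha, hb, ht⟩ := exists_step_of_cellStep M c h i hw
    refine hn ⟨c', h', hr.tail hs, fun t => ?_⟩
    rcases lt_trichotomy (t : ℕ) i with hlt | heq | hgt
    · rw [ht _ (by omega) (by omega)]
      exact (h₁ _ hlt).symm.trans (hc t)
    · simp only [heq]; exact ha
    · rcases Nat.lt_or_ge (i + 1) t with hlt | hge
      · rw [ht _ (by omega) (by omega), ← hc]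
        have := h₂ (t - (i + 1 + 1)) (by omega)
        rw [show i + 1 + 1 + (t - (i + 1 + 1)) = t by omega] at this
        exact this.symm
      · have ht : (t : ℕ) = i + 1 := by omega
        simp only [ht]; exact_mod_cast hb
  · rintro ⟨d, hb, h₁⟩
    simp only [holdsAt_pairPred, sameLetter, Matrix.cons_val_zero,
      Matrix.cons_val_one, Nat.zero_add, hp', hq] at hb h₁
    obtain ⟨hn, c, h, hr, hc⟩ := hb
    exact hn ⟨c, h, hr, fun t => (h₁ _ t.2).trans (hc t)⟩
  · rintro ⟨i, ⟨hw, d, hb, -⟩, -⟩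
    simp only [holdsAt_pairPred, Matrix.cons_val_zero, Nat.zero_add, hp] at hw hb
    obtain ⟨c, h, hr, hc⟩ := hb
    have hi : (e (p (i + 1))).2 = tapeCell c h i := hc ⟨i, by omega⟩
    rw [hi] at hw
    obtain ⟨q₀, hs, hM⟩ := hw
    obtain ⟨-, rfl, hd⟩ := tapeCell_snd_eq_some (Prod.ext rfl hs : tapeCell c h i = (_, some q₀))
    refine hh (Part.dom_iff_mem.2 ⟨c, StateTransition.mem_eval.2 ⟨hr, ?_⟩⟩)
    have hM' : M c.q c.Tape.head = none := hd ▸ hM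
    simpa [TM0.step] using hM'
  · rintro ⟨m, ht, h₁⟩
    rw [holdsAt_inputTail] at ht
    simp only [holdsAt_pairPred, letterIs, Matrix.cons_val_zero, Nat.zero_add, hp'] at ht h₁
    obtain ⟨h₂, d, hn, h₃⟩ := ht
    refine hn ⟨_, m, Relation.ReflTransGen.refl, fun t => ?_⟩
    have hin := tapeCell_init (Λ := Λ) a l m (t : ℕ)
    rcases Nat.lt_or_ge t m with hlt | hge
    · exact (h₁ _ hlt).trans (hin.2 (.inl (by omega))).symm
    · rcases Nat.lt_or_ge t (m + (inputCells (Λ := Λ) a l).length) with hlt | hge'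
      · have h4 := h₂ (t - m) (by omega)
        rw [hin.1 (t - m) (by omega) (by omega), ← h4, show m + (t - m) = (t : ℕ) by omega]
      · have h4 := h₃ (t - (m + (inputCells (Λ := Λ) a l).length)) (by omega)
        rw [show ∀ k, k ≤ (t : ℕ) → k + (t - k) = (t : ℕ) by intro k hk; omega] at h4
        · exact h4.trans (hin.2 (.inr (by omega))).symm
        · exact hge'

/-- Induction along the run puts every reachable configuration into the invariant, provided its word
leaves enough room on both sides of the head. -/
theorem not_halts_of_holdsAt_invariantFormula (a : Γ) (l : List Γ)
    (p q : (ℕ → TapeCell Γ Λ) → ℕ → S)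
    (hp : ∀ u j, (e (p u (j + 1))).2 = u j) (hq : ∀ u j, (e (q u (j + 1))).2 = u j)
    (H : ∀ u v, (invariantFormula e M (inputCells a l)).HoldsAt (fun s => {s}) ![p u, q v] 0) :
    ¬ (StateTransition.eval (TM0.step M) (TM0.init (a :: l))).Dom := by
  simp only [invariantFormula, HoldsAt, holdsAt_succ] at H
  have hstep := fun u v => (H u v).1.1
  have hagree := fun u v => (H u v).1.2.1
  have hhalt := fun u v => (H u v).1.2.2
  have hinput := fun u v => (H u v).2
  -- `m` is the initial head position, `δ` the net displacement of the head, and `K` a margin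
  -- keeping all rewritten cells inside the word.
  have key : ∀ c, TM0.Reaches M (TM0.init (a :: l)) c → ∃ (δ : ℤ) (K : ℕ), |δ| < K ∧
      ∀ m j : ℕ, K ≤ m → m + K ≤ j →
        (e (p (fun i => tapeCell c (m + δ) i) (j + 1))).1 = true := by
    intro c hc
    induction hc with
    | refl =>
      refine ⟨0, (inputCells (Λ := Λ) a l).length + 1, by simp, fun m j hm hj => ?_⟩
      by_contra hb
      rw [Bool.not_eq_true] at hb
      refine hinput (fun i => tapeCell (TM0.init (a :: l)) (m + 0) i) (fun _ => default) ⟨m, ?_, ?_⟩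
      · rw [holdsAt_inputTail]
        simp only [Matrix.cons_val_zero, Nat.zero_add, hp, add_zero]
        refine ⟨fun i hi => (tapeCell_init a l _ _).1 i hi (by push_cast; rfl),
          j - (m + (inputCells (Λ := Λ) a l).length), ?_, fun t ht => ?_⟩
        · rw [← hb, show ∀ k, k ≤ j → k + (j - k) = j by intro k hk; omega]
          · simp
          · omega
        · exact (tapeCell_init a l _ _).2 (.inr (by push_cast; omega))
      · intro t ht
        simp only [letterIs, holdsAt_pairPred, Matrix.cons_val_zero, Nat.zero_add, hp, add_zero]
        exact (tapeCell_init a l _ _).2 (.inl (by omega))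
    | @tail c c' _ hs ih =>
      obtain ⟨δ, K, hδ, ih⟩ := ih
      rw [abs_lt] at hδ
      obtain ⟨x, y, hx, hx', hy, hy', hs⟩ := exists_cellStep_of_step M hs
      -- The wider margin covers the head's move and both rewritten cells.
      refine ⟨δ + y, K + 2, by rw [abs_lt]; push_cast; omega, fun m j hm hj => ?_⟩
      specialize ih m j (by omega) (by omega)
      obtain ⟨i, hi⟩ : ∃ i : ℕ, (i : ℤ) = m + δ + x := ⟨(m + δ + x).toNat, by omega⟩
      obtain ⟨hs, ht⟩ := hs (m + δ) i (m + (δ + y)) hi (by omega)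
      by_contra hb
      rw [Bool.not_eq_true] at hb
      -- Feeding the same word to both paths turns rejection by the first strategy into rejection by
      -- the second, which the step condition contradicts.
      have hb' : (e (q (fun i => tapeCell c' (m + (δ + y)) i) (j + 1))).1 = false := by
        by_contra hb'
        rw [Bool.not_eq_false] at hb'
        refine hagree (fun i => tapeCell c' (m + (δ + y)) i)
          (fun i => tapeCell c' (m + (δ + y)) i) ⟨j, ?_, fun t _ => ?_⟩
        · simpa using ⟨hb, hb'⟩
        · simp [sameLetter, hp, hq]
      refine hstep (fun i => tapeCell c (m + δ) i) (fun i => tapeCell c' (m + (δ + y)) i)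
        ⟨i, ⟨?_, j - (i + 1 + 1), ?_, fun t _ => ?_⟩, fun t hti => ?_⟩
      · simpa [hp, hq] using hs
      · rw [holdsAt_pairPred, show 0 + i + 1 + 1 + (j - (i + 1 + 1)) = j by omega]
        exact ⟨ih, hb'⟩
      · simpa [sameLetter, hp, hq] using ht _ (by omega) (by omega)
      · simpa [sameLetter, hp, hq] using ht t (by omega) (by omega)
  intro hdom
  obtain ⟨c, hc⟩ := Part.dom_iff_mem.1 hdom
  obtain ⟨hr, hn⟩ := StateTransition.mem_eval.1 hc
  obtain ⟨δ, K, hδ, hb⟩ := key c hr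
  rw [abs_lt] at hδ
  specialize hb K (K + K) le_rfl le_rfl
  obtain ⟨i, hi⟩ : ∃ i : ℕ, (i : ℤ) = K + δ := ⟨(K + δ).toNat, by omega⟩
  refine hhalt (fun i => tapeCell c (K + δ) i) (fun _ => default)
    ⟨i, ⟨?_, K + K - (i + 1), ?_, ?_⟩, ?_⟩
  · simp only [holdsAt_pairPred, Matrix.cons_val_zero, Nat.zero_add, hp]
    refine ⟨c.q, by simp [tapeCell, hi], ?_⟩
    simp only [tapeCell, hi, sub_self, Tape.nth_zero]
    simpa [TM0.step] using hn
  · simp only [holdsAt_pairPred, Matrix.cons_val_zero, Nat.zero_add]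
    rw [show i + 1 + (K + K - (i + 1)) = K + K by omega]
    exact hb
  · simp
  · simp

end Invariant

/-! ### The reduction -/

section Reduction

open Turing LTL

/-- The Polish notation of `inputTail`. -/
theorem tokens_inputTail {S Γ Λ : Type} [Inhabited S] [Fintype S] [Inhabited Γ]
    (e : S ≃ Bool × TapeCell Γ Λ) (l : List (TapeCell Γ Λ)) :
    (inputTail e l).tokens =
      l.flatMap (fun a => Sum.inr 2 :: ((letterIs e a).tokens ++ [Sum.inr 1])) ++
        (inputTail e []).tokens := by
  induction l with
  | nil => rfl
  | cons a l ih =>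
    change Sum.inr 2 :: ((letterIs e a).tokens ++ Sum.inr 1 :: (inputTail e l).tokens) = _
    rw [ih]
    simp

theorem primrec_of_primrec_tokens {α AP V : Type} [Primcodable α] [Primcodable AP] [Primcodable V]
    {f : α → LTL AP V} (hf : Primrec fun a => (f a).tokens) : Primrec f := by
  let := Primcodable.subtype (LTL.primrecPred_wf (AP := AP) (V := V))
  have h : Primrec fun a => LTL.equivWords AP V (f a) :=
    Primrec.subtype_val_iff.1 hf
  exact (Primrec.of_equiv_iff (LTL.equivWords AP V)).1 h

theorem primrec_invariantFormula {S Γ Λ : Type} [Inhabited S] [Fintype S] [Inhabited Γ]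
    [Inhabited Λ] [Finite Γ] [Primcodable S] [Primcodable Γ] (e : S ≃ Bool × TapeCell Γ Λ)
    (M : TM0.Machine Γ Λ) (a : Γ) :
    Primrec fun l : List Γ => invariantFormula e M (inputCells a l) := by
  refine primrec_of_primrec_tokens ?_
  let g : TapeCell Γ Λ → List (Tok S (Fin 2)) :=
    fun a => Sum.inr 2 :: ((letterIs e a).tokens ++ [Sum.inr 1])
  have hg : Primrec fun l : List Γ => l.flatMap fun b => g (b, none) :=
    Primrec.list_flatMap Primrec.id
      ((Primrec.dom_finite fun b => g (b, none)).comp Primrec.snd).to₂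
  have hc : ∃ u v : List (Tok S (Fin 2)), ∀ l,
      (invariantFormula e M (inputCells a l)).tokens =
        u ++ (l.flatMap (fun b => g (b, none)) ++ v) := by
    let B : LTL S (Fin 2) := .and (.not (stepViolation e M))
      (.and (.not (agreementViolation e)) (.not (haltViolation e M)))
    refine ⟨Sum.inr 1 :: Sum.inr 2 :: (B.tokens ++ Sum.inr 0 :: Sum.inr 3 ::
      ((letterIs e (default, none)).tokens ++ g (a, some default))),
      (inputTail e []).tokens, fun l => ?_⟩
    change Sum.inr 1 :: Sum.inr 2 :: (B.tokens ++ Sum.inr 0 :: Sum.inr 3 ::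
      ((letterIs e (default, none)).tokens ++ (inputTail e (inputCells a l)).tokens)) = _
    rw [tokens_inputTail, inputCells, List.flatMap_cons, List.flatMap_map]
    simp only [g, List.cons_append, List.append_assoc, List.nil_append]
  obtain ⟨u, v, h⟩ := hc
  simp only [h]
  exact Primrec.list_append.comp (Primrec.const u) (Primrec.list_append.comp hg (Primrec.const v))

theorem models_invariantFormula_iff {S Γ Λ : Type} [Inhabited S] [Fintype S] [Inhabited Γ]
    [Inhabited Λ] (e : S ≃ Bool × TapeCell Γ Λ) (M : TM0.Machine Γ Λ) (a : Γ) (l : List Γ) :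
    (bitGame e default).Models (crossedFormula (invariantFormula e M (inputCells a l))) ↔
      ¬ (StateTransition.eval (TM0.step M) (TM0.init (a :: l))).Dom := by
  rw [models_crossedFormula_iff]
  constructor
  · rintro ⟨x, y, h⟩
    exact not_halts_of_holdsAt_invariantFormula e M a l
      (fun u => (bitGame e default).play default ![x, letterStrategy e u])
      (fun u => (bitGame e default).play default ![y, letterStrategy e u])
      (fun u j => play_letterStrategy e default x u j)
      (fun u j => play_letterStrategy e default y u j) fun u v => h _ _
  · intro h
    refine ⟨bitStrategy e (ShowsReachable M (TM0.init (a :: l))),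
      bitStrategy e (ShowsReachable M (TM0.init (a :: l))), fun z w => ?_⟩
    exact holdsAt_invariantFormula_of_not_halts e M a l h _ _
      (fun j => play_bitStrategy e default _ z j) fun j => play_bitStrategy e default _ w j

end Reduction

theorem mainTheorem6 :
    ∃ k : ℕ, ¬ ComputablePred fun I : CGSCode k × LTL (Fin k) (Fin 2) =>
      I.1.toCGS.Models (crossedFormula I.2) := by
  obtain ⟨Γ, Λ, _, _, _, _, _, M, a, r, hr, hM⟩ := exists_machine_halting_undecidable
  obtain ⟨n, ⟨e⟩⟩ := Finite.exists_equiv_fin (Bool × TapeCell Γ Λ)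
  obtain ⟨n, rfl⟩ : ∃ m, n = m + 1 :=
    Nat.exists_eq_succ_of_ne_zero (by rintro rfl; exact (e (true, default, none)).elim0)
  refine ⟨n + 1, fun hdec => hM ?_⟩
  obtain ⟨t, L, hG⟩ := CGSCode.exists_code (bitGame e.symm default)
  have hf : Computable fun i => (CGSCode.mk n n (bitGame e.symm default).init t L,
      invariantFormula e.symm M (inputCells a (r i))) :=
    (Computable.const _).pair ((primrec_invariantFormula e.symm M a).to_comp.comp hr)
  have hnot := (ComputablePred.computable_of_manyOneReducible ⟨_, hf, fun _ => Iff.rfl⟩ hdec).not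
  refine hnot.of_eq fun i => ?_
  -- The formula expresses non-halting, so its decidability is used through the complement.
  refine (not_congr ?_).trans not_not
  refine Iff.trans (iff_of_eq ?_) (models_invariantFormula_iff e.symm M a (r i))
  exact congrArg (fun G : CGS (Fin 2) (Fin (n + 1)) (Fin (n + 1)) (Fin (n + 1)) =>
    G.Models (crossedFormula (invariantFormula e.symm M (inputCells a (r i))))) hG
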